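/- Let $D\subset\mathbb R^d$ be open and bounded, let $H(D)$, $H_{\mathcal A}(D)$ and $H_{\mathcal B}(\partial D)$ be Hilbert spaces of real functions (on $D$, $D$ and $\partial D$ respectively) with continuous point evaluations, and let $\mathcal A:H(D)\to H_{\mathcal A}(D)$ and $\mathcal B:H(D)\to H_{\mathcal B}(\partial D)$ be linear and Borel measurable. Let $\mathcal A_\Lambda$ be a linear operator from a linear space of functions on $D$ (those $\varphi$ with $\mathcal A_\Lambda\varphi\in L^2(D)$) to $L^2(D)$, let $\mathcal B_\Lambda$ be a linear operator from the same space to functions on $\partial D$, and put $H_\Lambda(D)=\{\varphi : \mathcal A_\Lambda\varphi\in L^2(D),\ \mathcal B_\Lambda\varphi=0 \text{ on } \partial D\}$. Assume that $H_\Lambda(D)$ with $\langle\varphi,\psi\rangle_\Lambda=\int_D \mathcal A_\Lambda\varphi\,\mathcal A_\Lambda\psi\,\mathrm dx$ is a reproducing kernel Hilbert space with kernel $\Lambda:D\times D\to\mathbb R$, and that $H_\Lambda(D)\subseteq H_{\mathcal A}(D)$. Let $$H_k(D)=\{v\in H(D) : \mathcal A_\Lambda\mathcal A v\in L^2(D),\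 \mathcal B v=0 \text{ and } \mathcal B_\Lambda\mathcal A v=0 \text{ on } \partial D\},$$ and assume that the problem is well-posed: for every $\varphi\in H_\Lambda(D)$ there is a unique $v\in H_k(D)$ with $\mathcal A v=\varphi$. Let $G:D\times D\to\mathbb R$ be a measurable Green's function of $(\mathcal A,\mathcal B)$, that is, $\mathcal A G(\cdot,z)=\delta_z$ and $\mathcal B G(\cdot,z)=0$ in the following sense: for every $\varphi\in H_\Lambda(D)$ the integral $v(x)=\int_D G(x,z)\varphi(z)\,\mathrm dz$ converges absolutely for all $x\in D$, and $v\in H(D)$, $\mathcal A v=\varphi$, $\mathcal B v=0$. Define the natural kernel $$k(x,x')=\int_D\int_D G(x,z)\,G(x',z')\,\Lambda(z,z')\,\mathrm dz\,\mathrm dz' .$$ Let $(\Omega',\mathcal F',\mathbb P')$ be a probability space and let $g:D\times\Omega'\to\mathbb R$ be measurable with $g(\cdot,\omega')\in H_{\mathcal A}(D)$ for every $\omega'$. For every $\omega'$ let $u(\cdot,\omega')\in H(D)$ be the solution of $\mathcal A u=g$ in $D$, $\mathcal B u=0$ on $\partial D$, given by the absolutely convergent integral $$u(x,\omega')=\int_D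 G(x,z)\,g(z,\omega')\,\mathrm dz ,\qquad x\in D.$$ Then $g$ is a centred Gaussian process on $D$ with covariance function $\Lambda$ if and only if $u$ is a centred Gaussian process on $D$ with covariance function $k$. (A process is Gaussian if all its finite-dimensional distributions are Gaussian.) -/

import Mathlib

open MeasureTheory ProbabilityTheory

noncomputable section

/-- `X` is, under `P`, a centred Gaussian process with covariance function `K`: all its
finite-dimensional distributions are Gaussian, its mean function vanishes, and the covariance of
`X s` and `X t` is `K s t`. -/
def IsCentredGaussianProcess {T Ω : Type*} [MeasurableSpace Ω] (X : T → Ω → ℝ) (K : T → T → ℝ)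
    (P : Measure Ω) : Prop :=
  IsGaussianProcess X P ∧ (∀ t, ∫ ω, X t ω ∂P = 0) ∧ ∀ s t, cov[X s, X t; P] = K s t

/-- Lebesgue measure on `D`, as a measure on the subtype. -/
abbrev lebesgueOn {d : ℕ} (D : Set (EuclideanSpace ℝ (Fin d))) : Measure D :=
  (volume : Measure (EuclideanSpace ℝ (Fin d))).comap Subtype.val

/-- The natural kernel `k(x, x') = ∫_D ∫_D G(x, z) G(x', z') Λ(z, z') dz dz'`. -/
def naturalKernel {d : ℕ} {D : Set (EuclideanSpace ℝ (Fin d))} (G Λ : D → D → ℝ) (x x' : D) : ℝ :=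
  ∫ z', ∫ z, G x z * G x' z' * Λ z z' ∂(lebesgueOn D) ∂(lebesgueOn D)

/-- The space `H_Λ(D)` of functions `φ` on `D` with `A_Λ φ ∈ L²(D)` and `B_Λ φ = 0` on the boundary.
The operator `A_Λ` is represented with its `L²`-domain `{φ | A_Λ φ ∈ L²(D)}`, so that
`φ ∈ A_Λ.domain` says that `A_Λ φ` is in `L²(D)`. -/
def forcingSpace {d : ℕ} {D : Set (EuclideanSpace ℝ (Fin d))}
    (AΛ : (D → ℝ) →ₗ.[ℝ] Lp ℝ 2 (lebesgueOn D))
    (BΛ : AΛ.domain →ₗ[ℝ] (frontier D → ℝ)) : Submodule ℝ (D → ℝ) :=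
  (LinearMap.ker BΛ).map AΛ.domain.subtype

/-- `H_Λ(D)`, with the inner product `⟨φ, ψ⟩_Λ = ⟨A_Λ φ, A_Λ ψ⟩_{L²(D)}`, is a reproducing kernel
Hilbert space with kernel `Λ`: every section `Λ(·, x)` lies in `H_Λ(D)` and reproduces the value
at `x`, and `H_Λ(D)` is complete (as `A_Λ` is an isometry of `H_Λ(D)` onto its image in `L²(D)`,
this says that the image is complete). -/
structure IsReproducingKernelOf {d : ℕ} {D : Set (EuclideanSpace ℝ (Fin d))}
    (AΛ : (D → ℝ) →ₗ.[ℝ] Lp ℝ 2 (lebesgueOn D))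
    (BΛ : AΛ.domain →ₗ[ℝ] (frontier D → ℝ)) (Λ : D → D → ℝ) : Prop where
  reproducing : ∀ x : D, ∃ s : AΛ.domain, (s : D → ℝ) = (fun z => Λ z x) ∧ BΛ s = 0 ∧
    ∀ φ : AΛ.domain, BΛ φ = 0 → inner ℝ (AΛ φ) (AΛ s) = (φ : D → ℝ) x
  complete : IsComplete ((fun φ : AΛ.domain => AΛ φ) '' {φ | BΛ φ = 0})

section System

variable {d : ℕ} {D : Set (EuclideanSpace ℝ (Fin d))} {H HA HB : Type*}
  [NormedAddCommGroup H] [InnerProductSpace ℝ H] [RKHS ℝ H D ℝ]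
  [NormedAddCommGroup HA] [InnerProductSpace ℝ HA] [RKHS ℝ HA D ℝ]
  [NormedAddCommGroup HB] [InnerProductSpace ℝ HB]

/-- The space `H_k(D)` of all `v ∈ H(D)` with `A_Λ A v ∈ L²(D)`, and `B v = 0` and `B_Λ A v = 0` on
the boundary. -/
def solutionSpace (A : H →ₗ[ℝ] HA) (B : H →ₗ[ℝ] HB)
    (AΛ : (D → ℝ) →ₗ.[ℝ] Lp ℝ 2 (lebesgueOn D))
    (BΛ : AΛ.domain →ₗ[ℝ] (frontier D → ℝ)) : Set H :=
  {v | (∃ h : ⇑(A v) ∈ AΛ.domain, BΛ ⟨⇑(A v), h⟩ = 0) ∧ B v = 0}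

/-- Well-posedness: for every `φ ∈ H_Λ(D)` there is a unique `v ∈ H_k(D)` with `A v = φ`. -/
def IsWellPosed (A : H →ₗ[ℝ] HA) (B : H →ₗ[ℝ] HB)
    (AΛ : (D → ℝ) →ₗ.[ℝ] Lp ℝ 2 (lebesgueOn D))
    (BΛ : AΛ.domain →ₗ[ℝ] (frontier D → ℝ)) : Prop :=
  ∀ φ ∈ forcingSpace AΛ BΛ, ∃! v : H, v ∈ solutionSpace A B AΛ BΛ ∧ ⇑(A v) = φ

/-- `v ∈ H(D)` is the Green's integral `∫_D G(·, z) φ(z) dz` (an absolutely convergent integral),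
and it solves `A v = φ` on `D`, `B v = 0` on the boundary. -/
structure IsGreenSolution (A : H →ₗ[ℝ] HA) (B : H →ₗ[ℝ] HB) (G : D → D → ℝ) (φ : D → ℝ)
    (v : H) : Prop where
  integrable : ∀ x : D, Integrable (fun z : D => G x z * φ z) (lebesgueOn D)
  eq_integral : ∀ x : D, v x = ∫ z, G x z * φ z ∂(lebesgueOn D)
  solves : ⇑(A v) = φ
  boundary : B v = 0

/-- `G` is a Green's function of the system `(A, B)` for the forcing terms in `S`. The equations
`A G(·, z) = δ_z` and `B G(·, z) = 0` are understood in integrated form, that is, paired in `z` with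
a forcing term `φ ∈ S`: `A ∫ G(·, z) φ(z) dz = ∫ δ_z φ(z) dz = φ` and `B ∫ G(·, z) φ(z) dz = 0`. -/
def IsGreenFunction (A : H →ₗ[ℝ] HA) (B : H →ₗ[ℝ] HB) (G : D → D → ℝ) (S : Set (D → ℝ)) : Prop :=
  Measurable (Function.uncurry G) ∧ ∀ φ ∈ S, ∃ v : H, IsGreenSolution A B G φ v

end System

end

/-! From `g` to `u`: each `u(x)` is an integral of a path of `g` against the weight `G(x, ·)`. The
first and second absolute moments of centred Gaussians are comparable, so almost sure absolute
convergence already forces `∫ |G(x, z)| σ(z) dz < ∞`, with `σ(z)` the standard deviation of `g(z)`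
(`lintegral_enorm_mul_eLpNorm_lt_top`). Hence Fubini applies in `L²(P)`: anything orthogonal to all
`g(z)` is orthogonal to `u(x)`, so `u(x)` lies in the closed linear span of the `g(z)`. That span
consists of centred Gaussians, and Fubini turns the covariance into `k`.

From `u` to `g`: `A` and `B` are continuous, being Borel measurable and linear on a Banach space. By
the closed graph theorem the Green integral is then a continuous operator `T : H_Λ → H`, and `k(x,
x') = ⟪T* K_x, T* K_x'⟫` for the kernel sections `K_x` of `H`. Density of their span makes every
pairing `⟪u, w⟫` centred Gaussian, with covariance `⟪T* w, T* w'⟫`. Now `g(x) = (A u)(x)` is the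
pairing of `u` with `w = A* K^A_x`, where `K^A_x` is the section of `H_A`. Since `A T φ = φ` as
functions, `T* w` is the kernel section of `H_Λ` at `x`, so the covariance is `Λ`. The paths of `g`
themselves need not lie in `H_Λ`. -/

open Filter Topology
open scoped InnerProductSpace ENNReal NNReal

/-! ### Automatic continuity of Borel linear maps -/

/-- A Borel measurable linear map from a Banach space to a normed space is continuous. -/
theorem LinearMap.continuous_of_measurable_borel {E F : Type*} [NormedAddCommGroup E]
    [NormedSpace ℝ E] [CompleteSpace E] [NormedAddCommGroup F] [NormedSpace ℝ F]
    (T : E →ₗ[ℝ] F) (hT : Measurable[borel E, borel F] T) : Continuous T := by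
  borelize E F
  have hcover : (⋃ n : ℕ, T ⁻¹' Metric.closedBall 0 n) = Set.univ := by
    refine Set.eq_univ_of_forall fun x => Set.mem_iUnion.2 ?_
    obtain ⟨n, hn⟩ := exists_nat_ge ‖T x‖
    exact ⟨n, by simpa using hn⟩
  -- Baire category: countably many meagre sets cannot cover the complete space `E`.
  obtain ⟨n, hn⟩ : ∃ n : ℕ, ¬ IsMeagre (T ⁻¹' Metric.closedBall 0 (n : ℝ)) := by
    by_contra! h
    have := isMeagre_iUnion h
    rw [hcover] at this
    exact not_isMeagre_of_isOpen isOpen_univ Set.univ_nonempty this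
  set S := T ⁻¹' Metric.closedBall 0 (n : ℝ)
  have hS : MeasurableSet S := hT Metric.isClosed_closedBall.measurableSet
  -- A Borel set has the Baire property. As in Pettis's theorem, for small `h` the open set `U ∩ (U
  -- + h)` is nonempty, so some `x` has both `x` and `x - h` in `S`.
  obtain ⟨U, hUo, hSU⟩ := hS.baireMeasurableSet.residualEq_isOpen
  have hUne : U.Nonempty := by
    by_contra! hU
    refine hn ?_
    subst hU
    rw [IsMeagre]
    filter_upwards [hSU] with x hx hxS
    exact hx.mp hxS
  obtain ⟨x₀, hx₀⟩ := hUne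
  obtain ⟨r, hr, hball⟩ := Metric.isOpen_iff.1 hUo x₀ hx₀
  have hbound : ∀ h : E, ‖h‖ < r → ‖T h‖ ≤ 2 * n := by
    intro h hh
    have hres : ∀ᶠ x in residual E, (x - h ∈ S ↔ x - h ∈ U) := by
      have := (tendsto_residual_of_isOpenMap (Homeomorph.subRight h).continuous
        (Homeomorph.subRight h).isOpenMap).eventually hSU
      filter_upwards [this] with x hx using hx.to_iff
    have hV : IsOpen (U ∩ (fun x => x - h) ⁻¹' U) := hUo.inter (hUo.preimage (by fun_prop))
    have hVne : (U ∩ (fun x => x - h) ⁻¹' U).Nonempty :=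
      ⟨x₀ + h, hball (by simpa using hh), by simpa using hx₀⟩
    obtain ⟨x, hxS, hxS', hxV⟩ : ∃ x, (x ∈ S ↔ x ∈ U) ∧ (x - h ∈ S ↔ x - h ∈ U) ∧
        x ∈ U ∩ (fun x => x - h) ⁻¹' U := by
      by_contra! hcon
      refine not_isMeagre_of_isOpen hV hVne ?_
      rw [IsMeagre]
      filter_upwards [hSU, hres] with x h1 h2
      exact hcon x h1.to_iff h2
    have h1 : ‖T x‖ ≤ n := by simpa [S] using hxS.2 hxV.1
    have h2 : ‖T (x - h)‖ ≤ n := by simpa [S] using hxS'.2 hxV.2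
    calc ‖T h‖ = ‖T x - T (x - h)‖ := by rw [← map_sub]; simp
      _ ≤ ‖T x‖ + ‖T (x - h)‖ := norm_sub_le _ _
      _ ≤ 2 * n := by linarith
  -- The bound `2 * n` applied to the rescaling of `x` to norm `r / 2` gives the constant `4 * n /
  -- r`.
  refine AddMonoidHomClass.continuous_of_bound T (4 * n / r) fun x => ?_
  rcases eq_or_ne x 0 with rfl | hx
  · simp
  have hx' : 0 < ‖x‖ := norm_pos_iff.2 hx
  have h := hbound ((r / (2 * ‖x‖)) • x) (by
    rw [norm_smul, Real.norm_of_nonneg (by positivity)]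
    field_simp
    linarith)
  rw [map_smul, norm_smul, Real.norm_of_nonneg (by positivity)] at h
  field_simp at h ⊢
  linarith

/-! ### Closed linear spans of Gaussian variables in L² -/

section GaussianClosure

variable {Ω : Type*} [MeasurableSpace Ω] {P : Measure Ω}

/-- The square-integrable centred Gaussian random variables form a closed subset of `L²`. -/
theorem isClosed_setOf_map_eq_gaussianReal [IsProbabilityMeasure P] :
    IsClosed {f : Lp ℝ 2 P | P.map f = gaussianReal 0 (‖f‖₊ ^ 2)} := by
  refine IsSeqClosed.isClosed fun F f hF hf => ?_
  have hm (g : Lp ℝ 2 P) : AEMeasurable g P := (Lp.aestronglyMeasurable g).aemeasurable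
  -- Along an almost surely convergent subsequence the characteristic functions converge by
  -- dominated convergence; the variances converge because the norm is continuous.
  obtain ⟨ns, hns, hae⟩ := (tendstoInMeasure_of_tendsto_Lp hf).exists_seq_tendsto_ae
  have := Measure.isProbabilityMeasure_map (hm f)
  refine Measure.ext_of_charFun (funext fun t => ?_)
  have h1 : Tendsto (fun n => charFun (P.map (F (ns n))) t) atTop (𝓝 (charFun (P.map f) t)) := by
    simp_rw [charFun_apply_real]
    have key (g : Lp ℝ 2 P) : ∫ x, Complex.exp (t * x * Complex.I) ∂(P.map g)
        = ∫ ω, Complex.exp (t * g ω * Complex.I) ∂P :=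
      integral_map (hm g) (by fun_prop)
    simp_rw [key]
    refine tendsto_integral_of_dominated_convergence (fun _ => 1) (fun n => ?_)
      (integrable_const _) (fun n => ae_of_all _ fun ω => ?_) ?_
    · have := hm (F (ns n))
      fun_prop
    · rw [← Complex.ofReal_mul, Complex.norm_exp_ofReal_mul_I]
    · filter_upwards [hae] with ω hω
      exact ((by fun_prop : Continuous fun x : ℝ => Complex.exp (t * x * Complex.I)).tendsto
        (f ω)).comp hω
  have h2 : Tendsto (fun n => charFun (P.map (F (ns n))) t) atTop
      (𝓝 (charFun (gaussianReal 0 (‖f‖₊ ^ 2)) t)) := by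
    have hF' (n : ℕ) : P.map (F (ns n)) = gaussianReal 0 (‖F (ns n)‖₊ ^ 2) := hF (ns n)
    simp_rw [hF', charFun_gaussianReal]
    have := (hf.comp hns.tendsto_atTop).norm
    refine ((by fun_prop : Continuous fun s : ℝ =>
      Complex.exp (t * (0 : ℝ) * Complex.I - (s : ℂ) ^ 2 * t ^ 2 / 2)).tendsto ‖f‖).comp this |>.congr
        (fun n => ?_) |>.trans_eq ?_
    · simp
    · simp
  exact tendsto_nhds_unique h1 h2

/-- A square-integrable process in the `L²`-closure of the linear span of a centred Gaussian
process is a centred Gaussian process. -/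
theorem isGaussianProcess_of_mem_topologicalClosure_span {T S : Type*} {X : T → Ω → ℝ}
    (hX : IsGaussianProcess X P) (hX0 : ∀ t, ∫ ω, X t ω ∂P = 0)
    (hX2 : ∀ t, MemLp (X t) 2 P) {Y : S → Ω → ℝ} (f : S → Lp ℝ 2 P) (hfY : ∀ s, f s =ᵐ[P] Y s)
    (hf : ∀ s, f s ∈ (Submodule.span ℝ (Set.range fun t => (hX2 t).toLp)).topologicalClosure) :
    IsGaussianProcess Y P ∧ ∀ s, ∫ ω, Y s ω ∂P = 0 := by
  have := hX.isProbabilityMeasure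
  have hspan : ∀ g ∈ Submodule.span ℝ (Set.range fun t => (hX2 t).toLp),
      P.map g = gaussianReal 0 (‖g‖₊ ^ 2) := by
    intro g hg
    obtain ⟨c, rfl⟩ := (Finsupp.mem_span_range_iff_exists_finsupp).1 hg
    set g := c.sum fun i a => a • (hX2 i).toLp with hgdef
    have hgae : g =ᵐ[P] fun ω => ∑ i : c.support, c i * X i ω := by
      rw [hgdef, Finsupp.sum, ← Finset.sum_coe_sort]
      refine (Lp.coeFn_finsetSum _ _).trans ?_
      have : ∀ᵐ ω ∂P, ∀ i : c.support, (c i • (hX2 i).toLp : Lp ℝ 2 P) ω = c i * X i ω := by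
        refine ae_all_iff.2 fun i => ?_
        filter_upwards [Lp.coeFn_smul (c i) (hX2 i).toLp, (hX2 i).coeFn_toLp] with ω h1 h2
        simp [h1, h2]
      filter_upwards [this] with ω hω
      simp [hω]
    have hlaw : HasGaussianLaw g P := by
      refine HasGaussianLaw.congr ?_ hgae.symm
      have := (hX.hasGaussianLaw c.support).map_fun
        (∑ i : c.support, c i • ContinuousLinearMap.proj (R := ℝ) (φ := fun _ => ℝ) i)
      simpa using this
    have hmean : ∫ ω, g ω ∂P = 0 := by
      rw [integral_congr_ae hgae, integral_finsetSum _ fun (i : c.support) _ =>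
        ((hX2 (i : T)).integrable one_le_two).const_mul (c i)]
      simp [integral_const_mul, hX0]
    rw [hlaw.map_eq_gaussianReal, hmean, variance_of_integral_eq_zero hlaw.aemeasurable hmean]
    congr 1
    rw [← NNReal.coe_inj, Real.coe_toNNReal _ (integral_nonneg fun ω => sq_nonneg _)]
    push_cast
    rw [← real_inner_self_eq_norm_sq, L2.inner_def]
    simp [pow_two]
  have hcl : ∀ g ∈ (Submodule.span ℝ (Set.range fun t => (hX2 t).toLp)).topologicalClosure,
      P.map g = gaussianReal 0 (‖g‖₊ ^ 2) := fun g hg =>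
    closure_minimal hspan isClosed_setOf_map_eq_gaussianReal hg
  refine ⟨⟨fun I => ⟨?_⟩⟩, fun s => ?_⟩
  · have hmeas : AEMeasurable (fun ω => I.restrict (Y · ω)) P := by
      refine aemeasurable_pi_lambda _ fun i => ?_
      exact ((Lp.aestronglyMeasurable (f i)).congr (hfY i)).aemeasurable
    -- Cramér–Wold: a linear functional of finitely many `Y s` is again an element of the closed
    -- span.
    refine isGaussian_of_map_eq_gaussianReal fun L => ?_
    classical
    set g : Lp ℝ 2 P := ∑ i : I, L (Pi.single i 1) • f i
    have hg : g =ᵐ[P] fun ω => L (I.restrict (Y · ω)) := by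
      refine (Lp.coeFn_finsetSum _ _).trans ?_
      have : ∀ᵐ ω ∂P, ∀ i : I, (L (Pi.single i 1) • f i : Lp ℝ 2 P) ω
          = L (Pi.single i 1) * Y i ω := by
        refine ae_all_iff.2 fun i => ?_
        filter_upwards [Lp.coeFn_smul (L (Pi.single i 1)) (f i), hfY i] with ω h1 h2
        simp [h1, h2]
      filter_upwards [this] with ω hω
      conv_rhs => rw [← Finset.univ_sum_single (I.restrict (Y · ω)), map_sum]
      simp only [Finset.sum_apply, hω]
      refine Finset.sum_congr rfl fun i _ => ?_
      rw [← mul_one (I.restrict (Y · ω) i), ← smul_eq_mul (a := I.restrict (Y · ω) i),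
        Pi.single_smul, map_smul, smul_eq_mul, mul_comm]
      rfl
    refine ⟨0, ‖g‖₊ ^ 2, ?_⟩
    rw [← hcl g (Submodule.sum_mem _ fun i _ => Submodule.smul_mem _ _ (hf i)),
      AEMeasurable.map_map_of_aemeasurable (by fun_prop) hmeas]
    exact Measure.map_congr hg.symm
  · have h := hcl (f s) (hf s)
    rw [← integral_congr_ae (hfY s), ← integral_id_gaussianReal (μ := 0) (v := ‖f s‖₊ ^ 2), ← h,
      integral_map (Lp.aestronglyMeasurable (f s)).aemeasurable (by fun_prop)]

/-- The covariance of centred square-integrable random variables is their inner product in `L²`. -/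
theorem covariance_eq_inner_of_integral_eq_zero {X Y : Ω → ℝ} {f g : Lp ℝ 2 P} (hf : f =ᵐ[P] X)
    (hg : g =ᵐ[P] Y) (hX : ∫ ω, X ω ∂P = 0) (hY : ∫ ω, Y ω ∂P = 0) :
    cov[X, Y; P] = inner ℝ f g := by
  rw [covariance, hX, hY, L2.inner_def]
  refine integral_congr_ae ?_
  filter_upwards [hf, hg] with ω h1 h2
  simp [h1, h2, mul_comm]

end GaussianClosure

/-! ### The Green operator and its adjoint -/

section GreenOperator

variable {d : ℕ} {D : Set (EuclideanSpace ℝ (Fin d))} {H HA HB R : Type*}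
  [NormedAddCommGroup H] [InnerProductSpace ℝ H] [RKHS ℝ H D ℝ]
  [NormedAddCommGroup HA] [InnerProductSpace ℝ HA] [RKHS ℝ HA D ℝ]
  [NormedAddCommGroup HB] [InnerProductSpace ℝ HB]
  [NormedAddCommGroup R] [InnerProductSpace ℝ R] [RKHS ℝ R D ℝ]
  [CompleteSpace H] [CompleteSpace R]

/-- If the Green's integral solves a well-posed problem `A v = φ`, `B v = 0` for all `φ` in a
reproducing kernel Hilbert space `R`, then it is a continuous linear function of `φ`. -/
theorem exists_greenOperator (A : H →ₗ[ℝ] HA) (hA : Continuous A) (B : H →ₗ[ℝ] HB)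
    (hB : Continuous B) (G : D → D → ℝ) (hsol : ∀ φ : R, ∃ v : H, IsGreenSolution A B G φ v)
    (huniq : ∀ (φ : R) (v v' : H), ⇑(A v) = φ → B v = 0 → ⇑(A v') = φ → B v' = 0 → v = v') :
    ∃ T : R →L[ℝ] H, ∀ φ : R, IsGreenSolution A B G φ (T φ) := by
  choose T hT using hsol
  let T' : R →ₗ[ℝ] H :=
    { toFun := T
      map_add' := fun φ ψ => huniq (φ + ψ) _ _ (hT _).solves (hT _).boundary
        (by rw [map_add, RKHS.coe_add, RKHS.coe_add, (hT φ).solves, (hT ψ).solves])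
        (by rw [map_add, (hT φ).boundary, (hT ψ).boundary, add_zero])
      map_smul' := fun c φ => huniq (c • φ) _ _ (hT _).solves (hT _).boundary
        (by rw [map_smul, RingHom.id_apply, RKHS.coe_smul, RKHS.coe_smul, (hT φ).solves])
        (by rw [RingHom.id_apply, map_smul, (hT φ).boundary, smul_zero]) }
  have hcont : Continuous T' := by
    -- Closed graph: both equations pass to the limit, `A v = ψ` pointwise through the continuous
    -- evaluations, and uniqueness identifies the limit with `T ψ`.
    refine T'.continuous_of_seq_closed_graph fun φ ψ v hφ hv => ?_
    refine huniq ψ _ _ ?_ ?_ (hT ψ).solves (hT ψ).boundary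
    · funext x
      have h1 : Tendsto (fun n => A (T (φ n)) x) atTop (𝓝 (A v x)) :=
        (((RKHS.continuous_eval x).comp hA).tendsto v).comp hv
      have h2 : Tendsto (fun n => φ n x) atTop (𝓝 (ψ x)) :=
        ((RKHS.continuous_eval x).tendsto ψ).comp hφ
      simp_rw [(hT _).solves] at h1
      exact tendsto_nhds_unique h1 h2
    · have h1 : Tendsto (fun n => B (T (φ n))) atTop (𝓝 (B v)) := (hB.tendsto v).comp hv
      simp_rw [(hT _).boundary] at h1
      exact tendsto_nhds_unique h1 tendsto_const_nhds
  exact ⟨⟨T', hcont⟩, hT⟩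

/-- The natural kernel is the Gram matrix of the images of the kernel sections of `H` under the
adjoint of the Green operator. -/
theorem naturalKernel_eq_inner (G : D → D → ℝ) (T : R →L[ℝ] H)
    (hT : ∀ (φ : R) (x : D), T φ x = ∫ z, G x z * φ z ∂(lebesgueOn D)) (x x' : D) :
    naturalKernel G (fun z z' => ⟪RKHS.kerFun R z (1 : ℝ), RKHS.kerFun R z' (1 : ℝ)⟫_ℝ) x x'
      = ⟪T.adjoint (RKHS.kerFun H x (1 : ℝ)), T.adjoint (RKHS.kerFun H x' (1 : ℝ))⟫_ℝ := by
  have hk (z' : D) : ∫ z, G x z * G x' z' * ⟪RKHS.kerFun R z (1 : ℝ), RKHS.kerFun R z' (1 : ℝ)⟫_ℝ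
      ∂(lebesgueOn D) = G x' z' * (T.adjoint (RKHS.kerFun H x (1 : ℝ))) z' := by
    -- Reproducing in `R` and then in `H` shows that the inner integral is `T* K_x` at `z'`; the
    -- outer integral is then `T T* K_x` at `x'`.
    have : T.adjoint (RKHS.kerFun H x (1 : ℝ)) z' = T (RKHS.kerFun R z' (1 : ℝ)) x := by
      have h1 := RKHS.kerFun_inner z' (1 : ℝ) (T.adjoint (RKHS.kerFun H x (1 : ℝ)))
      rw [ContinuousLinearMap.adjoint_inner_right, RKHS.inner_kerFun] at h1
      simpa using h1.symm
    rw [this, hT, ← integral_const_mul]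
    refine integral_congr_ae (ae_of_all _ fun z => ?_)
    simp only [RKHS.kerFun_inner]
    simp
    ring
  simp only [naturalKernel, hk]
  rw [← hT, ContinuousLinearMap.adjoint_inner_right, RKHS.inner_kerFun]
  simp

end GreenOperator

/-! ### Pairings of a random element of a reproducing kernel Hilbert space -/

section WeaklyGaussian

variable {X H R : Type*} [NormedAddCommGroup H] [InnerProductSpace ℝ H] [RKHS ℝ H X ℝ]
  [CompleteSpace H] [NormedAddCommGroup R] [InnerProductSpace ℝ R]
  {Ω : Type*} [MeasurableSpace Ω] {P : Measure Ω}

/-- If the coordinates of a random element `u` of a reproducing kernel Hilbert space form a centred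
Gaussian process whose covariance is the Gram matrix of the images of the kernel sections under a
continuous linear map `S`, then all `⟪u, w⟫` form such a process. -/
theorem IsCentredGaussianProcess.inner_left {u : Ω → H} (S : H →L[ℝ] R)
    (hu : IsCentredGaussianProcess (fun (x : X) ω => u ω x)
      (fun x x' => ⟪S (RKHS.kerFun H x (1 : ℝ)), S (RKHS.kerFun H x' (1 : ℝ))⟫_ℝ) P) :
    IsCentredGaussianProcess (fun (w : H) ω => ⟪u ω, w⟫_ℝ) (fun w w' => ⟪S w, S w'⟫_ℝ) P := by
  obtain ⟨hG, h0, hcov⟩ := hu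
  have := hG.isProbabilityMeasure
  have hu2 (x : X) : MemLp (fun ω => u ω x) 2 P := (hG.hasGaussianLaw_eval x).memLp_two
  set K : X → H := fun x => RKHS.kerFun H x (1 : ℝ)
  have hKu (x : X) (v : H) : ⟪v, K x⟫_ℝ = v x := by simp [K]
  set N : Submodule ℝ H := Submodule.span ℝ (Set.range K)
  have hNdense : Dense (N : Set H) := by
    have h : {x | ∃ a : X, ∃ v : ℝ, RKHS.kerFun H a v = x} ⊆ N := by
      rintro _ ⟨x, v, rfl⟩
      rw [← mul_one v, ← smul_eq_mul, map_smul]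
      exact N.smul_mem _ (Submodule.subset_span ⟨x, rfl⟩)
    rw [Submodule.dense_iff_topologicalClosure_eq_top, ← top_le_iff, ← RKHS.kerFun_dense H]
    exact Submodule.topologicalClosure_mono (Submodule.span_le.2 h)
  have hmem (w : N) : MemLp (fun ω => ⟪u ω, (w : H)⟫_ℝ) 2 P := by
    obtain ⟨w, hw⟩ := w
    induction hw using Submodule.span_induction with
    | mem w hw => obtain ⟨x, rfl⟩ := hw; simpa [hKu] using hu2 x
    | zero => simp
    | add w w' _ _ h h' => simp only [inner_add_right]; exact h.add h'
    | smul c w _ h => simpa [inner_smul_right] using h.const_mul c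
  let J : N →ₗ[ℝ] Lp ℝ 2 P :=
    { toFun := fun w => (hmem w).toLp
      map_add' := fun w w' => by
        rw [← MemLp.toLp_add]
        congr 1
        ext ω
        simp [inner_add_right]
      map_smul' := fun c w => by
        rw [RingHom.id_apply, ← MemLp.toLp_const_smul]
        congr 1
        ext ω
        simp [inner_smul_right] }
  have hJae (w : N) : J w =ᵐ[P] fun ω => ⟪u ω, (w : H)⟫_ℝ := (hmem w).coeFn_toLp
  have hJK (x : X) : J ⟨K x, Submodule.subset_span ⟨x, rfl⟩⟩ = (hu2 x).toLp := by
    simp [J, hKu]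
  -- On kernel sections this is the covariance hypothesis; bilinearity extends it to the span. It
  -- bounds `J` by `‖S‖`, so `J` extends continuously to `H`.
  have hinner : ∀ w w' : N, ⟪J w, J w'⟫_ℝ = ⟪S w, S w'⟫_ℝ := by
    rintro ⟨w, hw⟩ ⟨w', hw'⟩
    induction hw using Submodule.span_induction with
    | mem w hw =>
      induction hw' using Submodule.span_induction with
      | mem w' hw' =>
        obtain ⟨x, rfl⟩ := hw
        obtain ⟨x', rfl⟩ := hw'
        rw [hJK, hJK]
        exact (covariance_eq_inner_of_integral_eq_zero (hu2 x).coeFn_toLp (hu2 x').coeFn_toLp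
          (h0 x) (h0 x')).symm.trans (hcov x x')
      | zero =>
        have : J ⟨0, N.zero_mem⟩ = 0 := map_zero J
        simp [this]
      | add v v' hv hv' h h' =>
        have : J ⟨v + v', N.add_mem hv hv'⟩ = J ⟨v, hv⟩ + J ⟨v', hv'⟩ := map_add J ⟨v, hv⟩ ⟨v', hv'⟩
        rw [this, inner_add_right, h, h', map_add, inner_add_right]
      | smul c v hv h =>
        have : J ⟨c • v, N.smul_mem c hv⟩ = c • J ⟨v, hv⟩ := map_smul J c ⟨v, hv⟩
        rw [this, inner_smul_right, h, map_smul, inner_smul_right]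
    | zero =>
      have : J ⟨0, N.zero_mem⟩ = 0 := map_zero J
      simp [this]
    | add v v' hv hv' h h' =>
      have : J ⟨v + v', N.add_mem hv hv'⟩ = J ⟨v, hv⟩ + J ⟨v', hv'⟩ := map_add J ⟨v, hv⟩ ⟨v', hv'⟩
      rw [this, inner_add_left, h, h', map_add, inner_add_left]
    | smul c v hv h =>
      have : J ⟨c • v, N.smul_mem c hv⟩ = c • J ⟨v, hv⟩ := map_smul J c ⟨v, hv⟩
      rw [this, real_inner_smul_left, h, map_smul, real_inner_smul_left]
  have hbound (w : N) : ‖J w‖ ≤ ‖S‖ * ‖w‖ := by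
    have : ‖J w‖ = ‖S w‖ := by
      rw [@norm_eq_sqrt_real_inner _ _ _ (J w), hinner, ← norm_eq_sqrt_real_inner]
    rw [this]
    exact S.le_opNorm _
  have hdr : DenseRange N.subtypeL := by simpa [DenseRange] using hNdense
  let JC : N →L[ℝ] Lp ℝ 2 P := J.mkContinuous ‖S‖ hbound
  let J' : H →L[ℝ] Lp ℝ 2 P := JC.extend N.subtypeL
  have hJ' (w : N) : J' w = J w :=
    JC.extend_eq hdr N.subtypeₗᵢ.isometry.isUniformInducing w
  have hcl (w : H) : J' w ∈ (Submodule.span ℝ (Set.range fun x => (hu2 x).toLp)).topologicalClosure := by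
    refine hdr.induction_on (p := fun w => J' w ∈ _) w ?_ ?_
    · exact (Submodule.isClosed_topologicalClosure _).preimage J'.continuous
    · rintro ⟨w, hw⟩
      refine Submodule.le_topologicalClosure _ ?_
      change J' ((⟨w, hw⟩ : N) : H) ∈ _
      rw [hJ']
      induction hw using Submodule.span_induction with
      | mem w hw => obtain ⟨x, rfl⟩ := hw; rw [hJK]; exact Submodule.subset_span ⟨x, rfl⟩
      | zero =>
        have : J ⟨0, N.zero_mem⟩ = 0 := map_zero J
        rw [this]
        exact Submodule.zero_mem _
      | add v v' hv hv' h h' =>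
        have : J ⟨v + v', N.add_mem hv hv'⟩ = J ⟨v, hv⟩ + J ⟨v', hv'⟩ :=
          map_add J ⟨v, hv⟩ ⟨v', hv'⟩
        rw [this]
        exact Submodule.add_mem _ h h'
      | smul c v hv h =>
        have : J ⟨c • v, N.smul_mem c hv⟩ = c • J ⟨v, hv⟩ := map_smul J c ⟨v, hv⟩
        rw [this]
        exact Submodule.smul_mem _ _ h
  have hinner' (w w' : H) : ⟪J' w, J' w'⟫_ℝ = ⟪S w, S w'⟫_ℝ := by
    refine hdr.induction_on₂ (p := fun w w' => ⟪J' w, J' w'⟫_ℝ = ⟪S w, S w'⟫_ℝ) ?_ ?_ w w'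
    · exact isClosed_eq (by fun_prop) (by fun_prop)
    · intro w w'
      change ⟪J' (w : H), J' (w' : H)⟫_ℝ = ⟪S (w : H), S (w' : H)⟫_ℝ
      rw [hJ', hJ', hinner]
  have hae (w : H) : J' w =ᵐ[P] fun ω => ⟪u ω, w⟫_ℝ := by
    -- For each fixed `ω` the pairing with `u ω` is continuous, so the pointwise limit must agree
    -- with the almost sure limit of an `L²`-convergent subsequence.
    obtain ⟨v, hvN, hv⟩ := mem_closure_iff_seq_limit.1 (hNdense w)
    have hJv : Tendsto (fun n => J' (v n)) atTop (𝓝 (J' w)) := (J'.continuous.tendsto w).comp hv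
    obtain ⟨ns, hns, h⟩ := (tendstoInMeasure_of_tendsto_Lp hJv).exists_seq_tendsto_ae
    have h2 : ∀ᵐ ω ∂P, ∀ n, J' (v n) ω = ⟪u ω, v n⟫_ℝ := by
      refine ae_all_iff.2 fun n => ?_
      have := hJ' ⟨v n, hvN n⟩
      simp only at this
      rw [this]
      exact hJae _
    filter_upwards [h, h2] with ω h h2
    simp_rw [h2] at h
    exact tendsto_nhds_unique h
      (((by fun_prop : Continuous fun w => ⟪u ω, w⟫_ℝ).tendsto w).comp (hv.comp hns.tendsto_atTop))
  obtain ⟨hGY, hY0⟩ := isGaussianProcess_of_mem_topologicalClosure_span hG h0 hu2 J' hae hcl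
  exact ⟨hGY, hY0, fun w w' => (covariance_eq_inner_of_integral_eq_zero (hae w) (hae w') (hY0 w)
    (hY0 w')).trans (hinner' w w')⟩

end WeaklyGaussian

/-! ### Weighted path integrals of Gaussian processes -/

section GaussianIntegral

/-- The first and second absolute moments of centred Gaussian variables are comparable. -/
theorem exists_eLpNorm_two_le_mul_eLpNorm_one : ∃ C : ℝ≥0, ∀ {Ω : Type*} [MeasurableSpace Ω]
    {P : Measure Ω} {X : Ω → ℝ}, HasGaussianLaw X P → ∫ ω, X ω ∂P = 0 →
    eLpNorm X 2 P ≤ C * eLpNorm X 1 P := by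
  let γ := gaussianReal 0 1
  have h1 : eLpNorm id 1 γ ≠ 0 := by
    intro h
    rw [eLpNorm_eq_zero_iff (by fun_prop) one_ne_zero] at h
    have : NullSingletonClass γ := nullSingletonClass_gaussianReal one_ne_zero
    have h0 : ∀ᵐ x ∂γ, x ≠ 0 := by simp [ae_iff]
    obtain ⟨x, hx, hx'⟩ := (h.and h0).exists
    exact hx' hx
  have h2 : eLpNorm id 2 γ ≠ ∞ := (memLp_id_gaussianReal (μ := 0) (v := 1) 2).eLpNorm_ne_top
  refine ⟨(eLpNorm id 2 γ / eLpNorm id 1 γ).toNNReal, fun {Ω _ P X} hX h0 => ?_⟩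
  rw [ENNReal.coe_toNNReal (ENNReal.div_ne_top h2 h1)]
  -- The law of `X` is that of a standard normal scaled by its standard deviation, so the ratio of
  -- the two norms does not depend on `X`.
  have key (p : ℝ≥0∞) : eLpNorm X p P = ‖√(Var[X; P].toNNReal)‖ₑ * eLpNorm id p γ := by
    have hmap := hX.map_eq_gaussianReal
    rw [h0] at hmap
    have hscale : gaussianReal 0 Var[X; P].toNNReal
        = γ.map (fun x => √(Var[X; P].toNNReal) * x) := by
      rw [gaussianReal_map_const_mul]
      congr 1
      · simp
      · ext
        simp
    have h3 : eLpNorm id p (P.map X) = eLpNorm X p P :=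
      eLpNorm_map_measure aestronglyMeasurable_id hX.aemeasurable
    have h4 : eLpNorm id p (γ.map (fun x => √(Var[X; P].toNNReal) * x))
        = eLpNorm (fun x => √(Var[X; P].toNNReal) * x) p γ :=
      eLpNorm_map_measure aestronglyMeasurable_id (by fun_prop)
    rw [← h3, hmap, hscale, h4]
    exact eLpNorm_const_smul (√(Var[X; P].toNNReal)) id p γ
  have h1' : eLpNorm id 1 γ ≠ ∞ := (memLp_id_gaussianReal (μ := 0) (v := 1) 1).eLpNorm_ne_top
  rw [key 1, key 2, mul_left_comm, ENNReal.div_mul_cancel h1 h1']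

theorem lintegral_enorm_mul_enorm_le {Ω : Type*} [MeasurableSpace Ω] {P : Measure Ω} {f g : Ω → ℝ}
    (hf : AEMeasurable f P) (hg : AEMeasurable g P) :
    ∫⁻ ω, ‖f ω‖ₑ * ‖g ω‖ₑ ∂P ≤ eLpNorm f 2 P * eLpNorm g 2 P := by
  have := ENNReal.lintegral_mul_le_Lp_mul_Lq P Real.HolderConjugate.two_two hf.enorm hg.enorm
  simpa [eLpNorm_eq_lintegral_rpow_enorm_toReal] using this

variable {E Ω : Type*} [MeasurableSpace E] [MeasurableSpace Ω] {ν : Measure E} {P : Measure Ω}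
  [SFinite ν] {X : E → Ω → ℝ} {K : E → E → ℝ} {h : E → ℝ}

theorem measurable_eLpNorm_two_of_measurable_uncurry [SFinite P]
    (hm : Measurable (Function.uncurry X)) : Measurable fun z => eLpNorm (X z) 2 P := by
  simp_rw [eLpNorm_eq_lintegral_rpow_enorm_toReal two_ne_zero ENNReal.ofNat_ne_top]
  refine Measurable.pow_const ?_ _
  exact Measurable.lintegral_prod_right' (f := fun p : E × Ω => ‖X p.1 p.2‖ₑ ^ _)
    (hm.enorm.pow_const _)

/-- If almost all paths of a measurable centred Gaussian process are integrable against a weight,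
then so is its standard deviation. -/
theorem lintegral_enorm_mul_eLpNorm_lt_top (hm : Measurable (Function.uncurry X))
    (hX : IsGaussianProcess X P) (hX0 : ∀ z, ∫ ω, X z ω ∂P = 0) (hh : Measurable h)
    (hint : ∀ᵐ ω ∂P, Integrable (fun z => h z * X z ω) ν) :
    ∫⁻ z, ‖h z‖ₑ * eLpNorm (X z) 2 P ∂ν < ∞ := by
  have := hX.isProbabilityMeasure
  obtain ⟨C, hC⟩ := exists_eLpNorm_two_le_mul_eLpNorm_one
  have hmX (z : E) : Measurable (X z) := hm.of_uncurry_left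
  set I : Ω → ℝ≥0∞ := fun ω => ∫⁻ z, ‖h z‖ₑ * ‖X z ω‖ₑ ∂ν
  have hmF : Measurable fun p : E × Ω => ‖h p.1‖ₑ * ‖X p.1 p.2‖ₑ :=
    (hh.comp measurable_fst).enorm.mul hm.enorm
  have hI : Measurable I := hmF.lintegral_prod_left'
  have hIfin : ∀ᵐ ω ∂P, I ω < ∞ := by
    filter_upwards [hint] with ω hω
    simpa [I, HasFiniteIntegral, enorm_mul] using hω.2
  -- The level `M` is independent of `z` and leaves so little mass outside `S` that, by
  -- Cauchy–Schwarz, the contribution of `Sᶜ` is at most half of `eLpNorm (X z) 2 P`.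
  obtain ⟨M, hM⟩ : ∃ M : ℕ, C * P {ω | I ω ≤ M}ᶜ ^ (1 / 2 : ℝ) ≤ 1 / 2 := by
    have hlim : Tendsto (fun n : ℕ => P {ω | I ω ≤ n}ᶜ) atTop (𝓝 (P (⋂ n : ℕ, {ω | I ω ≤ n}ᶜ))) := by
      refine tendsto_measure_iInter_atTop
        (fun n => (measurableSet_le hI measurable_const).compl.nullMeasurableSet) ?_
        ⟨0, measure_ne_top _ _⟩
      intro m n hmn
      refine Set.compl_subset_compl.2 fun ω (hω : I ω ≤ m) => hω.trans ?_
      exact_mod_cast hmn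
    have h0 : P (⋂ n : ℕ, {ω | I ω ≤ n}ᶜ) = 0 := by
      rw [← compl_mem_ae_iff]
      filter_upwards [hIfin] with ω hω
      obtain ⟨n, hn⟩ := ENNReal.exists_nat_gt hω.ne
      simp only [Set.mem_compl_iff, Set.mem_iInter, not_forall, not_not, Set.mem_ofPred_eq]
      exact ⟨n, hn.le⟩
    rw [h0] at hlim
    have h2 : Tendsto (fun n : ℕ => C * P {ω | I ω ≤ n}ᶜ ^ (1 / 2 : ℝ)) atTop (𝓝 0) := by
      have := ENNReal.Tendsto.const_mul (a := (C : ℝ≥0∞))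
        ((ENNReal.continuous_rpow_const (y := 1 / 2)).tendsto 0 |>.comp hlim)
        (Or.inr ENNReal.coe_ne_top)
      simpa using this
    exact (h2.eventually_le_const (by simp)).exists
  set S := {ω | I ω ≤ M}
  have hS : MeasurableSet S := measurableSet_le hI measurable_const
  have hbound (z : E) : eLpNorm (X z) 2 P ≤ 2 * (C * ∫⁻ ω in S, ‖X z ω‖ₑ ∂P) := by
    have hfin : eLpNorm (X z) 2 P ≠ ∞ := (hX.hasGaussianLaw_eval z).memLp_two.eLpNorm_ne_top
    have h1 : ∫⁻ ω in Sᶜ, ‖X z ω‖ₑ ∂P ≤ eLpNorm (X z) 2 P * P Sᶜ ^ (1 / 2 : ℝ) := by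
      have := eLpNorm_le_eLpNorm_mul_rpow_measure_univ (p := 1) (q := 2) one_le_two
        (hmX z).aestronglyMeasurable (μ := P.restrict Sᶜ)
      rw [eLpNorm_one_eq_lintegral_enorm] at this
      refine this.trans ?_
      rw [Measure.restrict_apply_univ]
      norm_num
      gcongr
      exact Measure.restrict_le_self
    have h2 : eLpNorm (X z) 2 P ≤ C * (∫⁻ ω in S, ‖X z ω‖ₑ ∂P) + eLpNorm (X z) 2 P / 2 := by
      calc eLpNorm (X z) 2 P ≤ C * eLpNorm (X z) 1 P := hC (hX.hasGaussianLaw_eval z) (hX0 z)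
        _ = C * (∫⁻ ω in S, ‖X z ω‖ₑ ∂P) + C * ∫⁻ ω in Sᶜ, ‖X z ω‖ₑ ∂P := by
            rw [eLpNorm_one_eq_lintegral_enorm, ← lintegral_add_compl _ hS, mul_add]
        _ ≤ C * (∫⁻ ω in S, ‖X z ω‖ₑ ∂P) + C * (eLpNorm (X z) 2 P * P Sᶜ ^ (1 / 2 : ℝ)) := by
            gcongr
        _ = C * (∫⁻ ω in S, ‖X z ω‖ₑ ∂P) + eLpNorm (X z) 2 P * (C * P Sᶜ ^ (1 / 2 : ℝ)) := by ring
        _ ≤ C * (∫⁻ ω in S, ‖X z ω‖ₑ ∂P) + eLpNorm (X z) 2 P * (1 / 2) := by gcongr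
        _ = _ := by rw [mul_one_div]
    -- The half is absorbed on the left, which requires the norm to be finite.
    nth_rw 1 [← ENNReal.add_halves (eLpNorm (X z) 2 P)] at h2
    have h3 := (ENNReal.add_le_add_iff_right (ENNReal.div_ne_top hfin two_ne_zero)).1 h2
    calc eLpNorm (X z) 2 P = 2 * (eLpNorm (X z) 2 P / 2) :=
          (ENNReal.mul_div_cancel two_ne_zero ENNReal.ofNat_ne_top).symm
      _ ≤ _ := by gcongr
  calc ∫⁻ z, ‖h z‖ₑ * eLpNorm (X z) 2 P ∂ν
      ≤ ∫⁻ z, 2 * C * ∫⁻ ω in S, ‖h z‖ₑ * ‖X z ω‖ₑ ∂P ∂ν := by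
        refine lintegral_mono fun z => ?_
        rw [lintegral_const_mul _ (hmX z).enorm]
        calc ‖h z‖ₑ * eLpNorm (X z) 2 P ≤ ‖h z‖ₑ * (2 * (C * ∫⁻ ω in S, ‖X z ω‖ₑ ∂P)) := by
              gcongr; exact hbound z
          _ = _ := by ring
    _ = 2 * C * ∫⁻ ω in S, I ω ∂P := by
        rw [lintegral_const_mul _ hmF.lintegral_prod_right',
          lintegral_lintegral_swap hmF.aemeasurable]
    _ ≤ 2 * C * ∫⁻ _ in S, M ∂P := by
        gcongr 2 * C * ?_
        exact setLIntegral_mono measurable_const fun ω hω => hω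
    _ < ∞ := by
        rw [setLIntegral_const]
        exact ENNReal.mul_lt_top (ENNReal.mul_lt_top (by simp) (by simp))
          (ENNReal.mul_lt_top (by simp) (measure_lt_top _ _))

-- Cauchy–Schwarz in `ω` for each fixed `z`. This is the absolute integrability that justifies
-- Fubini in `integral_integral_mul_mul`.
omit [SFinite ν] in
theorem lintegral_lintegral_enorm_mul_lt_top [IsProbabilityMeasure P]
    (hm : Measurable (Function.uncurry X)) (hh : Measurable h)
    (hfin : ∫⁻ z, ‖h z‖ₑ * eLpNorm (X z) 2 P ∂ν < ∞)
    {W : Ω → ℝ} (hW : MemLp W 2 P) :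
    ∫⁻ z, ∫⁻ ω, ‖h z * X z ω * W ω‖ₑ ∂P ∂ν < ∞ := by
  have hmX (z : E) : Measurable (X z) := hm.of_uncurry_left
  calc ∫⁻ z, ∫⁻ ω, ‖h z * X z ω * W ω‖ₑ ∂P ∂ν
      ≤ ∫⁻ z, ‖h z‖ₑ * eLpNorm (X z) 2 P * eLpNorm W 2 P ∂ν := by
        refine lintegral_mono fun z => ?_
        simp_rw [enorm_mul, mul_assoc]
        rw [lintegral_const_mul' _ _ enorm_ne_top]
        gcongr
        exact lintegral_enorm_mul_enorm_le (hmX z).aemeasurable hW.1.aemeasurable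
    _ = (∫⁻ z, ‖h z‖ₑ * eLpNorm (X z) 2 P ∂ν) * eLpNorm W 2 P :=
        lintegral_mul_const _ (hh.enorm.mul (measurable_eLpNorm_two_of_measurable_uncurry hm))
    _ < ∞ := ENNReal.mul_lt_top hfin hW.2

/-- The weighted integral of a process with integrable standard deviation is
square-integrable. -/
theorem memLp_two_integral_mul [IsProbabilityMeasure P]
    (hm : Measurable (Function.uncurry X)) (hh : Measurable h)
    (hfin : ∫⁻ z, ‖h z‖ₑ * eLpNorm (X z) 2 P ∂ν < ∞) :
    MemLp (fun ω => ∫ z, h z * X z ω ∂ν) 2 P := by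
  have hmX (z : E) : Measurable (X z) := hm.of_uncurry_left
  have hmF : Measurable fun p : E × Ω => h p.1 * X p.1 p.2 := (hh.comp measurable_fst).mul hm
  have hmI : Measurable fun ω => ∫⁻ z, ‖h z * X z ω‖ₑ ∂ν := hmF.enorm.lintegral_prod_left'
  refine ⟨hmF.stronglyMeasurable.integral_prod_left'.aestronglyMeasurable, ?_⟩
  set A := ∫⁻ z, ‖h z‖ₑ * eLpNorm (X z) 2 P ∂ν
  -- The square of the integral is expanded as a double integral; Cauchy–Schwarz on each pair `X z`,
  -- `X z'` bounds its expectation by `A * A`.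
  have hcross (z : E) : ∫⁻ ω, ‖X z ω‖ₑ * ∫⁻ z', ‖h z' * X z' ω‖ₑ ∂ν ∂P ≤ eLpNorm (X z) 2 P * A := by
    have hmG : Measurable fun p : Ω × E => ‖X z p.1‖ₑ * ‖h p.2 * X p.2 p.1‖ₑ :=
      ((hmX z).comp measurable_fst).enorm.mul (hmF.comp measurable_swap).enorm
    calc ∫⁻ ω, ‖X z ω‖ₑ * ∫⁻ z', ‖h z' * X z' ω‖ₑ ∂ν ∂P
        = ∫⁻ ω, ∫⁻ z', ‖X z ω‖ₑ * ‖h z' * X z' ω‖ₑ ∂ν ∂P := by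
          refine lintegral_congr fun ω => ?_
          rw [lintegral_const_mul]
          exact (hmF.comp (measurable_id.prodMk measurable_const)).enorm
      _ = ∫⁻ z', ∫⁻ ω, ‖X z ω‖ₑ * ‖h z' * X z' ω‖ₑ ∂P ∂ν :=
          lintegral_lintegral_swap hmG.aemeasurable
      _ ≤ ∫⁻ z', eLpNorm (X z) 2 P * (‖h z'‖ₑ * eLpNorm (X z') 2 P) ∂ν := by
          refine lintegral_mono fun z' => ?_
          simp_rw [enorm_mul, mul_left_comm _ ‖h z'‖ₑ]
          rw [lintegral_const_mul' _ _ enorm_ne_top]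
          gcongr
          exact lintegral_enorm_mul_enorm_le (hmX z).aemeasurable (hmX z').aemeasurable
      _ = eLpNorm (X z) 2 P * A :=
          lintegral_const_mul _ (hh.enorm.mul (measurable_eLpNorm_two_of_measurable_uncurry hm))
  have hsq : ∫⁻ ω, ‖∫ z, h z * X z ω ∂ν‖ₑ ^ (2 : ℝ) ∂P < ∞ := by
    have hmG : Measurable fun p : Ω × E => ‖h p.2 * X p.2 p.1‖ₑ * ∫⁻ z', ‖h z' * X z' p.1‖ₑ ∂ν :=
      (hmF.comp measurable_swap).enorm.mul (hmI.comp measurable_fst)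
    calc ∫⁻ ω, ‖∫ z, h z * X z ω ∂ν‖ₑ ^ (2 : ℝ) ∂P
        ≤ ∫⁻ ω, (∫⁻ z, ‖h z * X z ω‖ₑ ∂ν) ^ (2 : ℝ) ∂P := by
          gcongr
          exact enorm_integral_le_lintegral_enorm _
      _ = ∫⁻ ω, ∫⁻ z, ‖h z * X z ω‖ₑ * ∫⁻ z', ‖h z' * X z' ω‖ₑ ∂ν ∂ν ∂P := by
          refine lintegral_congr fun ω => ?_
          rw [lintegral_mul_const, ENNReal.rpow_two, pow_two]
          exact (hmF.comp (measurable_id.prodMk measurable_const)).enorm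
      _ = ∫⁻ z, ∫⁻ ω, ‖h z * X z ω‖ₑ * ∫⁻ z', ‖h z' * X z' ω‖ₑ ∂ν ∂P ∂ν :=
          lintegral_lintegral_swap hmG.aemeasurable
      _ ≤ ∫⁻ z, ‖h z‖ₑ * eLpNorm (X z) 2 P * A ∂ν := by
          refine lintegral_mono fun z => ?_
          simp_rw [fun ω => enorm_mul (h z) (X z ω), mul_assoc]
          rw [lintegral_const_mul' _ _ enorm_ne_top]
          gcongr
          exact hcross z
      _ = A * A :=
          lintegral_mul_const _ (hh.enorm.mul (measurable_eLpNorm_two_of_measurable_uncurry hm))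
      _ < ∞ := ENNReal.mul_lt_top hfin hfin
  rw [eLpNorm_lt_top_iff_lintegral_rpow_enorm_lt_top two_ne_zero ENNReal.ofNat_ne_top]
  simpa using hsq

/-- Fubini's theorem for the weighted integral of a process paired with a square-integrable random
variable. -/
theorem integral_integral_mul_mul [IsProbabilityMeasure P]
    (hm : Measurable (Function.uncurry X)) (hh : Measurable h)
    (hfin : ∫⁻ z, ‖h z‖ₑ * eLpNorm (X z) 2 P ∂ν < ∞)
    {W : Ω → ℝ} (hW : MemLp W 2 P) :
    ∫ ω, (∫ z, h z * X z ω ∂ν) * W ω ∂P = ∫ z, h z * ∫ ω, X z ω * W ω ∂P ∂ν := by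
  have hmF : Measurable fun p : Ω × E => h p.2 * X p.2 p.1 :=
    (hh.comp measurable_snd).mul (hm.comp measurable_swap)
  have hmeas : AEStronglyMeasurable (fun p : Ω × E => h p.2 * X p.2 p.1 * W p.1) (P.prod ν) :=
    hmF.aestronglyMeasurable.mul hW.1.comp_fst
  have hint : Integrable (fun p : Ω × E => h p.2 * X p.2 p.1 * W p.1) (P.prod ν) := by
    refine ⟨hmeas, ?_⟩
    rw [HasFiniteIntegral, lintegral_prod _ hmeas.enorm,
      lintegral_lintegral_swap hmeas.enorm]
    exact lintegral_lintegral_enorm_mul_lt_top hm hh hfin hW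
  simp_rw [← integral_mul_const]
  rw [integral_integral_swap hint]
  simp_rw [mul_assoc, integral_const_mul]

/-- Weighted integrals of the paths of a measurable centred Gaussian process form a centred Gaussian
process. -/
theorem IsCentredGaussianProcess.integral_mul {ι : Type*} (hm : Measurable (Function.uncurry X))
    (hX : IsCentredGaussianProcess X K P) {h : ι → E → ℝ} (hh : ∀ i, Measurable (h i))
    (hint : ∀ i, ∀ᵐ ω ∂P, Integrable (fun z => h i z * X z ω) ν) :
    IsCentredGaussianProcess (fun i ω => ∫ z, h i z * X z ω ∂ν)
      (fun i j => ∫ z', ∫ z, h i z * h j z' * K z z' ∂ν ∂ν) P := by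
  obtain ⟨hG, h0, hcov⟩ := hX
  have := hG.isProbabilityMeasure
  have hX2 (z : E) : MemLp (X z) 2 P := (hG.hasGaussianLaw_eval z).memLp_two
  have hfin (i : ι) := lintegral_enorm_mul_eLpNorm_lt_top hm hG h0 (hh i) (hint i)
  have hY2 (i : ι) := memLp_two_integral_mul hm (hh i) (hfin i)
  have hmem (i : ι) : (hY2 i).toLp ∈
      (Submodule.span ℝ (Set.range fun z => (hX2 z).toLp)).topologicalClosure := by
    -- The closed span is the double orthogonal complement, so no approximation of the integral by
    -- Riemann sums is needed.
    rw [← Submodule.orthogonal_orthogonal_eq_closure, Submodule.mem_orthogonal']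
    intro W hW
    have hXW (z : E) : ∫ ω, X z ω * W ω ∂P = 0 := by
      rw [← (Submodule.mem_orthogonal _ _).1 hW _ (Submodule.subset_span ⟨z, rfl⟩), L2.inner_def]
      refine integral_congr_ae ?_
      filter_upwards [(hX2 z).coeFn_toLp] with ω hω
      simp [hω, mul_comm]
    calc ⟪(hY2 i).toLp, W⟫_ℝ = ∫ ω, (∫ z, h i z * X z ω ∂ν) * W ω ∂P := by
          rw [L2.inner_def]
          refine integral_congr_ae ?_
          filter_upwards [(hY2 i).coeFn_toLp] with ω hω
          rw [hω, Real.inner_apply]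
      _ = 0 := by
          rw [integral_integral_mul_mul hm (hh i) (hfin i) (Lp.memLp W)]
          simp [hXW]
  obtain ⟨hGY, hY0⟩ := isGaussianProcess_of_mem_topologicalClosure_span hG h0 hX2
    (fun i => (hY2 i).toLp) (fun i => (hY2 i).coeFn_toLp) hmem
  refine ⟨hGY, hY0, fun i j => ?_⟩
  have hXcov (z z' : E) : ∫ ω, X z ω * X z' ω ∂P = K z z' := by
    rw [← hcov, covariance_eq_sub (hX2 z) (hX2 z'), h0, h0]
    simp
  -- The swap makes the integral of index `j` the outer one, matching the order of integration in
  -- the claimed covariance.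
  rw [covariance_comm, covariance_eq_sub (hY2 j) (hY2 i), hY0, hY0]
  simp only [Pi.mul_apply, mul_zero, sub_zero]
  rw [integral_integral_mul_mul hm (hh j) (hfin j) (hY2 i)]
  refine integral_congr_ae (ae_of_all _ fun z' => ?_)
  simp_rw [mul_comm (X z' _)]
  rw [integral_integral_mul_mul hm (hh i) (hfin i) (hX2 z'), ← integral_const_mul]
  refine integral_congr_ae (ae_of_all _ fun z => ?_)
  simp only [hXcov]
  ring

end GaussianIntegral

/-! ### `H_Λ(D)` as a reproducing kernel Hilbert space inside L² -/

/-- The image of `ker BΛ` under `AΛ`, the copy of `H_Λ(D)` in `L²(D)`. -/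
noncomputable def forcingRange {d : ℕ} {D : Set (EuclideanSpace ℝ (Fin d))}
    (AΛ : (D → ℝ) →ₗ.[ℝ] Lp ℝ 2 (lebesgueOn D))
    (BΛ : AΛ.domain →ₗ[ℝ] (frontier D → ℝ)) : Submodule ℝ (Lp ℝ 2 (lebesgueOn D)) :=
  (LinearMap.ker BΛ).map AΛ.toFun

namespace IsReproducingKernelOf

variable {d : ℕ} {D : Set (EuclideanSpace ℝ (Fin d))}
  {AΛ : (D → ℝ) →ₗ.[ℝ] Lp ℝ 2 (lebesgueOn D)} {BΛ : AΛ.domain →ₗ[ℝ] (frontier D → ℝ)}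
  {Λ : D → D → ℝ}

/-- `AΛ Λ(·, x)`, the representative of the evaluation at `x` in `L²(D)`. -/
noncomputable def evalRepr (hΛ : IsReproducingKernelOf AΛ BΛ Λ) (x : D) : Lp ℝ 2 (lebesgueOn D) :=
  AΛ (hΛ.reproducing x).choose

theorem inner_evalRepr (hΛ : IsReproducingKernelOf AΛ BΛ Λ) (φ : AΛ.domain) (hφ : BΛ φ = 0)
    (x : D) : ⟪AΛ φ, hΛ.evalRepr x⟫_ℝ = (φ : D → ℝ) x :=
  (hΛ.reproducing x).choose_spec.2.2 φ hφ

theorem evalRepr_mem (hΛ : IsReproducingKernelOf AΛ BΛ Λ) (x : D) :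
    hΛ.evalRepr x ∈ forcingRange AΛ BΛ :=
  ⟨_, (hΛ.reproducing x).choose_spec.2.1, rfl⟩

theorem inner_evalRepr_evalRepr (hΛ : IsReproducingKernelOf AΛ BΛ Λ) (x y : D) :
    ⟪hΛ.evalRepr x, hΛ.evalRepr y⟫_ℝ = Λ x y := by
  have h := (hΛ.reproducing x).choose_spec
  have := hΛ.inner_evalRepr _ h.2.1 y
  rw [h.1] at this
  rw [real_inner_comm]
  exact (hΛ.inner_evalRepr _ (hΛ.reproducing y).choose_spec.2.1 x).trans
    (congrFun (hΛ.reproducing y).choose_spec.1 x)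

/-- `H_Λ(D)`, realized in `L²(D)`, as a reproducing kernel Hilbert space of functions on `D`. -/
noncomputable abbrev rkhs (hΛ : IsReproducingKernelOf AΛ BΛ Λ) : RKHS ℝ (forcingRange AΛ BΛ) D ℝ where
  coeCLM := ContinuousLinearMap.pi fun x =>
    (innerSL ℝ (hΛ.evalRepr x)).comp (forcingRange AΛ BΛ).subtypeL
  coeCLM_injective := by
    refine (injective_iff_map_eq_zero _).2 ?_
    rintro ⟨_, φ, hφ, rfl⟩ h
    -- The value of `AΛ φ` at `x` is `φ x` by the reproducing property, so vanishing values force `φ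
    -- = 0`.
    have h0 : (φ : D → ℝ) = 0 := by
      funext x
      rw [← hΛ.inner_evalRepr φ hφ x, real_inner_comm]
      exact congrFun h x
    have : φ = 0 := Subtype.ext h0
    subst this
    exact Subtype.ext (map_zero AΛ.toFun)

theorem rkhs_apply (hΛ : IsReproducingKernelOf AΛ BΛ Λ) (y : forcingRange AΛ BΛ) (x : D) :
    letI := hΛ.rkhs
    y x = ⟪hΛ.evalRepr x, (y : Lp ℝ 2 (lebesgueOn D))⟫_ℝ := rfl

theorem coe_mem_forcingSpace (hΛ : IsReproducingKernelOf AΛ BΛ Λ) (y : forcingRange AΛ BΛ) :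
    letI := hΛ.rkhs
    ⇑y ∈ forcingSpace AΛ BΛ := by
  let := hΛ.rkhs
  obtain ⟨_, φ, hφ, rfl⟩ := y
  refine ⟨φ, hφ, funext fun x => ?_⟩
  rw [rkhs_apply, real_inner_comm]
  exact (hΛ.inner_evalRepr φ hφ x).symm

theorem completeSpace (hΛ : IsReproducingKernelOf AΛ BΛ Λ) :
    CompleteSpace (forcingRange AΛ BΛ) :=
  hΛ.complete.completeSpace_coe

/-- The kernel section at `x` is the Riesz representative of evaluation there, namely `AΛ Λ(·, x)`;
reproducing once more gives `Λ`. -/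
theorem inner_kerFun_kerFun (hΛ : IsReproducingKernelOf AΛ BΛ Λ) (x y : D) :
    letI := hΛ.rkhs
    letI := hΛ.completeSpace
    ⟪RKHS.kerFun (forcingRange AΛ BΛ) x (1 : ℝ), RKHS.kerFun (forcingRange AΛ BΛ) y (1 : ℝ)⟫_ℝ
      = Λ x y := by
  let := hΛ.rkhs
  let := hΛ.completeSpace
  have key (x : D) : RKHS.kerFun (forcingRange AΛ BΛ) x (1 : ℝ)
      = ⟨hΛ.evalRepr x, hΛ.evalRepr_mem x⟩ := by
    refine ext_inner_right ℝ fun y => ?_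
    rw [RKHS.kerFun_inner, rkhs_apply, Real.inner_apply, one_mul]
    rfl
  rw [key, key]
  exact hΛ.inner_evalRepr_evalRepr x y

end IsReproducingKernelOf

theorem isFiniteMeasure_lebesgueOn {d : ℕ} {D : Set (EuclideanSpace ℝ (Fin d))} (hDo : IsOpen D)
    (hDb : Bornology.IsBounded D) : IsFiniteMeasure (lebesgueOn D) := by
  refine ⟨?_⟩
  rw [(MeasurableEmbedding.subtype_coe hDo.measurableSet).comap_apply]
  simpa using hDb.measure_lt_top

/-! ### Recovering the forcing from the solution -/

section Pullback

variable {d : ℕ} {D : Set (EuclideanSpace ℝ (Fin d))} {H HA R : Type*}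
  [NormedAddCommGroup H] [InnerProductSpace ℝ H] [CompleteSpace H] [RKHS ℝ H D ℝ]
  [NormedAddCommGroup HA] [InnerProductSpace ℝ HA] [CompleteSpace HA] [RKHS ℝ HA D ℝ]
  [NormedAddCommGroup R] [InnerProductSpace ℝ R] [CompleteSpace R] [RKHS ℝ R D ℝ]
  {Ω : Type*} [MeasurableSpace Ω] {P : Measure Ω}

/-- If the solution is a centred Gaussian process with the natural kernel as covariance, then the
forcing term is a centred Gaussian process whose covariance is the kernel of `R`. -/
theorem isCentredGaussianProcess_of_solution (A : H →L[ℝ] HA) (G : D → D → ℝ) (T : R →L[ℝ] H)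
    (hT : ∀ (φ : R) (x : D), T φ x = ∫ z, G x z * φ z ∂(lebesgueOn D))
    (hAT : ∀ φ : R, ⇑(A (T φ)) = φ) {u : Ω → H}
    (hu : IsCentredGaussianProcess (fun (x : D) ω => u ω x) (naturalKernel G
      fun z z' => ⟪RKHS.kerFun R z (1 : ℝ), RKHS.kerFun R z' (1 : ℝ)⟫_ℝ) P) :
    IsCentredGaussianProcess (fun (x : D) ω => A (u ω) x)
      (fun z z' => ⟪RKHS.kerFun R z (1 : ℝ), RKHS.kerFun R z' (1 : ℝ)⟫_ℝ) P := by
  have hk : naturalKernel G (fun z z' => ⟪RKHS.kerFun R z (1 : ℝ), RKHS.kerFun R z' (1 : ℝ)⟫_ℝ)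
      = fun x x' => ⟪T.adjoint (RKHS.kerFun H x (1 : ℝ)), T.adjoint (RKHS.kerFun H x' (1 : ℝ))⟫_ℝ :=
    funext₂ (naturalKernel_eq_inner G T hT)
  rw [hk] at hu
  obtain ⟨hG, h0, hcov⟩ := hu.inner_left T.adjoint
  set w : D → H := fun x => A.adjoint (RKHS.kerFun HA x (1 : ℝ))
  have hw (v : H) (x : D) : ⟪v, w x⟫_ℝ = A v x := by
    rw [ContinuousLinearMap.adjoint_inner_right, RKHS.inner_kerFun]
    simp
  -- `A T` is the inclusion of `R` as functions, so evaluating `A T φ` at `x` is evaluating `φ` at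
  -- `x`; this is the adjoint form of that fact.
  have hTw (x : D) : T.adjoint (w x) = RKHS.kerFun R x (1 : ℝ) := by
    refine ext_inner_left ℝ fun φ => ?_
    rw [ContinuousLinearMap.adjoint_inner_right, hw, hAT, RKHS.inner_kerFun]
    simp
  simp_rw [← hw, ← hTw]
  exact ⟨hG.comp_right w, fun x => h0 (w x), fun x y => hcov (w x) (w y)⟩

end Pullback

theorem mainTheorem8 {d : ℕ} {D : Set (EuclideanSpace ℝ (Fin d))}
    (hDo : IsOpen D) (hDb : Bornology.IsBounded D)
    -- the Hilbert spaces of functions `H(D)`, `H_A(D)` and `H_B(∂D)`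
    {H HA HB : Type*}
    [NormedAddCommGroup H] [InnerProductSpace ℝ H] [CompleteSpace H] [RKHS ℝ H D ℝ]
    [NormedAddCommGroup HA] [InnerProductSpace ℝ HA] [CompleteSpace HA] [RKHS ℝ HA D ℝ]
    [NormedAddCommGroup HB] [InnerProductSpace ℝ HB] [CompleteSpace HB]
    [RKHS ℝ HB (frontier D) ℝ]
    -- the linear, Borel measurable operators of the system
    (A : H →ₗ[ℝ] HA) (hA : Measurable[borel H, borel HA] A)
    (B : H →ₗ[ℝ] HB) (hB : Measurable[borel H, borel HB] B)
    -- the operators that define `H_Λ(D)`, and its reproducing kernel `Λ`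
    (AΛ : (D → ℝ) →ₗ.[ℝ] Lp ℝ 2 (lebesgueOn D))
    (BΛ : AΛ.domain →ₗ[ℝ] (frontier D → ℝ))
    (Λ : D → D → ℝ) (hΛ : IsReproducingKernelOf AΛ BΛ Λ)
    (hΛA : ∀ φ ∈ forcingSpace AΛ BΛ, ∃ h : HA, ⇑h = φ)
    (hwp : IsWellPosed A B AΛ BΛ)
    (G : D → D → ℝ) (hG : IsGreenFunction A B G (forcingSpace AΛ BΛ))
    -- the random forcing and the solution
    {Ω' : Type*} [MeasurableSpace Ω'] (P' : Measure Ω') [IsProbabilityMeasure P']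
    (g : Ω' → HA) (hg : Measurable (fun p : D × Ω' => g p.2 p.1))
    (u : Ω' → H) (hu : ∀ ω, IsGreenSolution A B G (g ω) (u ω)) :
    IsCentredGaussianProcess (fun (x : D) (ω : Ω') => g ω x) Λ P' ↔
      IsCentredGaussianProcess (fun (x : D) (ω : Ω') => u ω x) (naturalKernel G Λ) P' := by

  have := isFiniteMeasure_lebesgueOn hDo hDb
  have hgu (x : D) (ω : Ω') : u ω x = ∫ z, G x z * g ω z ∂(lebesgueOn D) := (hu ω).eq_integral x
  have hgA (x : D) (ω : Ω') : g ω x = A (u ω) x := by rw [(hu ω).solves]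
  constructor
  · intro h
    have := h.integral_mul (ν := lebesgueOn D) (h := G) hg (fun x => hG.1.of_uncurry_left)
      (fun x => ae_of_all _ fun ω => (hu ω).integrable x)
    simp_rw [hgu]
    exact this
  · intro h
    let := hΛ.rkhs
    let := hΛ.completeSpace
    have hAc := A.continuous_of_measurable_borel hA
    have hBc := B.continuous_of_measurable_borel hB
    have huniq (φ : forcingRange AΛ BΛ) (v v' : H) (hv : ⇑(A v) = φ) (hBv : B v = 0)
        (hv' : ⇑(A v') = φ) (hBv' : B v' = 0) : v = v' := by
      have hφ := hΛ.coe_mem_forcingSpace φ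
      -- Well-posedness gives uniqueness only within `H_k`; a solution with forcing in `H_Λ` lies
      -- there automatically, since `A v = φ`.
      have hmem (v : H) (hv : ⇑(A v) = φ) (hBv : B v = 0) : v ∈ solutionSpace A B AΛ BΛ := by
        obtain ⟨ψ, hψ, hψφ⟩ := hφ
        rw [← hv] at hψφ
        refine ⟨⟨hψφ ▸ ψ.2, ?_⟩, hBv⟩
        rw [← LinearMap.mem_ker]
        convert! hψ
        exact hψφ.symm
      exact (hwp φ hφ).unique ⟨hmem v hv hBv, hv⟩ ⟨hmem v' hv' hBv', hv'⟩
    obtain ⟨T, hT⟩ := exists_greenOperator A hAc B hBc G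
      (fun φ : forcingRange AΛ BΛ => hG.2 φ (hΛ.coe_mem_forcingSpace φ)) huniq
    have hker : Λ = fun z z' => ⟪RKHS.kerFun (forcingRange AΛ BΛ) z (1 : ℝ),
        RKHS.kerFun (forcingRange AΛ BΛ) z' (1 : ℝ)⟫_ℝ :=
      funext₂ fun z z' => (hΛ.inner_kerFun_kerFun z z').symm
    rw [hker] at h ⊢
    simp_rw [hgA]
    exact isCentredGaussianProcess_of_solution ⟨A, hAc⟩ G T (fun φ x => (hT φ).eq_integral x)
      (fun φ => (hT φ).solves) h
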